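/- Let $n\ge 1$, let $Cl_n$ be the real Clifford algebra with generators $e_1,\dots,e_n$, $e_ie_j+e_je_i=-2\delta_{ij}$, with basis $e_A$ ($A\subseteq\{1,\dots,n\}$) and norm $\|\sum_A a_Ae_A\|=(\sum_A a_A^2)^{1/2}$. Let $\tilde a$, $a'$, $\overline a$ denote reversion, main involution and conjugation. Put $H^+=\{x=x_0+x_1e_1+\cdots+x_ne_n: x_n>0\}$. Let $SAV(\mathbb R\oplus\mathbb R^{n-1})$ be the special Ahlfors–Vahlen group of matrices $M=\begin{pmatrix}a&b\\c&d\end{pmatrix}$ whose entries are products of paravectors from $\mathbb R\oplus\mathbb R^{n-1}$, with $a\tilde d-b\tilde c=1$, and $ac^{-1},c^{-1}d\in\mathbb R\oplus\mathbb R^{n-1}$ if $c\ne0$, $bd^{-1}\in\mathbb R\oplus\mathbb R^{n-1}$ if $c=0$. Its rational subgroup $SAV(\mathbb R\oplus\mathbb R^{n-1},\mathbb Q)$ is given by the conditions: $a\overline a,b\overline b,c\overline c,d\overline d\in\mathbb Q$; $a\overline c,b\overline d\in\mathbb Q\oplus\mathbb Q^n$; and $ax\overline b+b\overline x\,\overline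 a,\ cx\overline d+d\overline x\,\overline c\in\mathbb Q$, $ax\overline d+b\overline x\,\overline c\in\mathbb Q\oplus\mathbb Q^n$ for all $x\in\mathbb Q\oplus\mathbb Q^n$. Let $\mathcal I$ be a $\mathbb Z$-order in the rational Clifford algebra $Cl_n(\mathbb Q)$ or $Cl_{n-1}(\mathbb Q)$ (a subring with finitely generated additive group containing a $\mathbb Q$-basis), stable under reversion and main involution. Let $N\ge1$, and put $\Gamma=SAV(\mathbb R\oplus\mathbb R^{n-1},\mathbb Q)\cap Mat(2,\mathcal I)$ and $\Gamma[N]=\{M\in\Gamma: a-1,b,c,d-1\in N\mathcal I\}$. For $M\in\Gamma$ write $M\langle x\rangle=(ax+b)(cx+d)^{-1}$. Let $\Lambda\subset\mathbb R\oplus\mathbb R^{n-1}$ be the lattice of those $\lambda$ with $\begin{pmatrix}1&\lambda\\0&1\end{pmatrix}\in\Gamma[N]$, and $\Lambda^*\subset\mathbb R\oplus\mathbb R^{n-1}$ its dual lattice. Let $k$ be an even integer and let $D=\sum_{i=0}^n e_i\partial_{x_i}$ (with $e_0=1$). A function $f:H^+\to Cl_n$ is called $k$-holomorphic Cliffordian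 if $f$ is $C^{k+1}$ and $D\Delta^{k/2}f=0$, when $k\ge0$; and if $x_n^{-k}f$ is $(2-k)$-holomorphic Cliffordian, when $k<0$. Such an $f$ is a $k$-holomorphic Cliffordian automorphic form on $\Gamma[N]$ if $$f(x)=\frac{\overline{cx+d}}{\|cx+d\|^{n+1-k}}\,f(M\langle x\rangle)\qquad(x\in H^+,\ M\in\Gamma[N]).$$ It is a $k$-holomorphic Cliffordian cusp form of weight $(n-k)$ on $\Gamma[N]$ if in addition, for every $M\in\Gamma$, $$\lim_{x_n\to+\infty}x_n^{-k}\,\frac{\overline{cx_ne_n+d}}{\|cx_ne_n+d\|^{n+1-k}}\,f(M\langle x_ne_n\rangle)=0\quad\text{if }k\le0,$$ and the same without the factor $x_n^{-k}$ if $k>0$. Theorem. Let $f$ be a $k$-holomorphic Cliffordian automorphic form on $\Gamma[N]$, and let $\mathcal R$ be any system of representatives of the right cosets of $\Gamma$ modulo $\Gamma[N]$. Suppose that for each $R=\begin{pmatrix}a&b\\c&d\end{pmatrix}\in\mathcal R$ the function $F(x;R)=\frac{\overline{cx+d}}{\|cx+d\|^{n+1-k}}f(R\langle x\rangle)$ has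 on $H^+$ a Fourier expansion (unconditionally convergent at every point) $$F(x;R)=a(0;R)+\alpha(0;R)x_n^k+b(0;R)e_nx_n+\beta(0;R)e_nx_n^{k+1}+\sum_{\omega\in\Lambda^*\setminus\{0\}}x_n^{\frac{k+1}2}\Big[K_{\frac{k+1}2}(2\pi\|\omega\|x_n)\,\alpha(\omega;R)+K_{\frac{k-1}2}(2\pi\|\omega\|x_n)\,\beta(\omega;R)e_n\Big]e^{2\pi i\langle\omega,x\rangle}$$ with $a(0;R),\ b(0;R),\ \alpha(\omega;R),\ \beta(\omega;R)$ ($\omega\in\Lambda^*$, including $\omega=0$) in the complexification of $Cl_{n-1}$, where $K_\nu$ is the modified Bessel function of the second kind, and suppose that the null-frequency part $a(0;R)+\alpha(0;R)x_n^k+b(0;R)e_nx_n+\beta(0;R)e_nx_n^{k+1}$ vanishes identically in $x_n>0$. Then $f$ is a $k$-holomorphic Cliffordian cusp form of weight $(n-k)$ on $\Gamma[N]$. -/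

import Mathlib

open Filter Topology MeasureTheory

noncomputable section

namespace CliffordForms

/-! ## Clifford algebras -/

/-- The quadratic form `v ↦ -∑ vᵢ²` on `𝕜ⁿ`. -/
abbrev negSumSq (𝕜 : Type) [RCLike 𝕜] (n : ℕ) : QuadraticForm 𝕜 (Fin n → 𝕜) :=
  QuadraticMap.weightedSumSquares 𝕜 (fun _ : Fin n => (-1 : 𝕜))

/-- The Clifford algebra with `eᵢ eⱼ + eⱼ eᵢ = -2 δᵢⱼ`; `Cl ℝ n` is the real algebra `Cl_n`
and `Cl ℂ n` its complexification. The generator `e_{i+1}` has the index `i : Fin n`. -/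
abbrev Cl (𝕜 : Type) [RCLike 𝕜] (n : ℕ) : Type := CliffordAlgebra (negSumSq 𝕜 n)

/-- The generators `e_1, …, e_n`. -/
def gen (𝕜 : Type) [RCLike 𝕜] {n : ℕ} (i : Fin n) : Cl 𝕜 n :=
  CliffordAlgebra.ι (negSumSq 𝕜 n) (Pi.single i 1)

/-- The product of the generators whose indices are in a list. -/
def listProd (𝕜 : Type) [RCLike 𝕜] {n : ℕ} (l : List (Fin n)) : Cl 𝕜 n :=
  (l.map (gen 𝕜)).prod

/-- `e_A`, the product of the `eᵢ`, `i ∈ A`, in increasing order. -/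
def blade (𝕜 : Type) [RCLike 𝕜] {n : ℕ} (A : Finset (Fin n)) : Cl 𝕜 n :=
  listProd 𝕜 (A.sort (· ≤ ·))

theorem gen_mul_self (𝕜 : Type) [RCLike 𝕜] {n : ℕ} (i : Fin n) :
    gen 𝕜 i * gen 𝕜 i = -1 := by
  have h : negSumSq 𝕜 n (Pi.single i 1) = -1 := by
    simp [negSumSq, QuadraticMap.weightedSumSquares_apply, Pi.single_apply]
  rw [gen, CliffordAlgebra.ι_sq_scalar, h, map_neg, map_one]

theorem gen_mul_swap (𝕜 : Type) [RCLike 𝕜] {n : ℕ} {i j : Fin n} (h : i ≠ j) :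
    gen 𝕜 i * gen 𝕜 j = -(gen 𝕜 j * gen 𝕜 i) := by
  have hp : QuadraticMap.polar (negSumSq 𝕜 n) (Pi.single i 1) (Pi.single j 1) = 0 := by
    simp only [QuadraticMap.polar, negSumSq, QuadraticMap.weightedSumSquares_apply,
      ← Finset.sum_sub_distrib]
    refine Finset.sum_eq_zero fun l _ => ?_
    by_cases h1 : l = i
    · subst h1; simp [h]
    · simp [h1]
  have := CliffordAlgebra.ι_mul_ι_add_swap (Q := negSumSq 𝕜 n) (Pi.single i 1) (Pi.single j 1)
  rw [hp, map_zero] at this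
  exact eq_neg_of_add_eq_zero_left this

theorem gen_mul_listProd (𝕜 : Type) [RCLike 𝕜] {n : ℕ} (i : Fin n) (l : List (Fin n))
    (hl : l.Pairwise (· < ·)) :
    ∃ l' : List (Fin n), l'.Pairwise (· < ·) ∧ (∀ j ∈ l', j = i ∨ j ∈ l) ∧
      (gen 𝕜 i * listProd 𝕜 l = listProd 𝕜 l' ∨ gen 𝕜 i * listProd 𝕜 l = -listProd 𝕜 l') := by
  induction l with
  | nil => exact ⟨[i], by simp, by simp, by simp [listProd]⟩
  | cons j t ih =>
    rw [List.pairwise_cons] at hl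
    obtain ⟨hj, ht⟩ := hl
    rcases lt_trichotomy i j with hij | hij | hij
    · refine ⟨i :: j :: t, ?_, by simp, Or.inl (by simp [listProd])⟩
      refine List.pairwise_cons.2 ⟨?_, List.pairwise_cons.2 ⟨hj, ht⟩⟩
      intro a ha
      rcases List.mem_cons.1 ha with rfl | ha
      · exact hij
      · exact hij.trans (hj a ha)
    · subst hij
      refine ⟨t, ht, fun a ha => Or.inr (List.mem_cons_of_mem _ ha), Or.inr ?_⟩
      simp [listProd, ← mul_assoc, gen_mul_self]
    · obtain ⟨t', h1, h2, h3⟩ := ih ht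
      refine ⟨j :: t', List.pairwise_cons.2 ⟨?_, h1⟩, ?_, ?_⟩
      · intro a ha
        rcases h2 a ha with rfl | h
        · exact hij
        · exact hj a h
      · intro a ha
        rcases List.mem_cons.1 ha with rfl | ha
        · simp
        · rcases h2 a ha with rfl | h
          · simp
          · simp [h]
      · have e : gen 𝕜 i * listProd 𝕜 (j :: t) = -(gen 𝕜 j * (gen 𝕜 i * listProd 𝕜 t)) := by
          simp only [listProd, List.map_cons, List.prod_cons, ← mul_assoc]
          rw [gen_mul_swap 𝕜 hij.ne', neg_mul]
        have e' : listProd 𝕜 (j :: t') = gen 𝕜 j * listProd 𝕜 t' := by simp [listProd]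
        rw [e, e']
        rcases h3 with h3 | h3
        · right; rw [h3]
        · left; rw [h3]; simp

theorem listProd_sorted (𝕜 : Type) [RCLike 𝕜] {n : ℕ} (l : List (Fin n))
    (hl : l.Pairwise (· < ·)) : listProd 𝕜 l = blade 𝕜 l.toFinset := by
  rw [blade, List.toFinset_sort (r := (· ≤ ·)) (hl.imp (fun h => ne_of_lt h)) |>.2
    (hl.imp (fun h => le_of_lt h))]

theorem span_blade (𝕜 : Type) [RCLike 𝕜] (n : ℕ) :
    ⊤ ≤ Submodule.span 𝕜 (Set.range (blade 𝕜 : Finset (Fin n) → Cl 𝕜 n)) := by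
  have hgen : ∀ (i : Fin n) (x : Cl 𝕜 n),
      x ∈ Submodule.span 𝕜 (Set.range (blade 𝕜 : Finset (Fin n) → Cl 𝕜 n)) →
      gen 𝕜 i * x ∈ Submodule.span 𝕜 (Set.range (blade 𝕜 : Finset (Fin n) → Cl 𝕜 n)) := by
    intro i x hx
    induction hx using Submodule.span_induction with
    | mem x hx =>
      obtain ⟨A, rfl⟩ := hx
      obtain ⟨l', h1, -, h3⟩ := gen_mul_listProd 𝕜 i (A.sort (· ≤ ·)) (Finset.sortedLT_sort A).pairwise
      rw [listProd_sorted 𝕜 l' h1] at h3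
      rcases h3 with h3 | h3
      · rw [blade, h3]; exact Submodule.subset_span ⟨_, rfl⟩
      · rw [blade, h3]; exact Submodule.neg_mem _ (Submodule.subset_span ⟨_, rfl⟩)
    | zero => simp
    | add x y _ _ hx hy => rw [mul_add]; exact Submodule.add_mem _ hx hy
    | smul c x _ hx => rw [mul_smul_comm]; exact Submodule.smul_mem _ c hx
  intro x _
  induction x using CliffordAlgebra.left_induction with
  | algebraMap r =>
    rw [Algebra.algebraMap_eq_smul_one]
    refine Submodule.smul_mem _ _ (Submodule.subset_span ⟨∅, by simp [blade, listProd]⟩)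
  | add x y hx hy => exact Submodule.add_mem _ (hx trivial) (hy trivial)
  | ι_mul x m hx =>
    have hm : CliffordAlgebra.ι (negSumSq 𝕜 n) m = ∑ i, m i • gen 𝕜 i := by
      conv_lhs => rw [← Finset.univ_sum_single m]
      rw [map_sum]
      refine Finset.sum_congr rfl fun i _ => ?_
      rw [gen, ← map_smul]
      congr 1
      rw [← Pi.single_smul]; simp
    rw [hm, Finset.sum_mul]
    refine Submodule.sum_mem _ fun i _ => ?_
    rw [smul_mul_assoc]
    exact Submodule.smul_mem _ _ (hgen i x (hx trivial))

theorem card_eq_finrank (𝕜 : Type) [RCLike 𝕜] (n : ℕ) :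
    Fintype.card (Finset (Fin n)) = Module.finrank 𝕜 (Cl 𝕜 n) := by
  let _ : Invertible (2 : 𝕜) := invertibleOfNonzero two_ne_zero
  rw [(CliffordAlgebra.equivExterior (negSumSq 𝕜 n)).finrank_eq,
    Module.finrank_eq_card_basis (Pi.basisFun 𝕜 (Fin n)).ExteriorAlgebra]

/-- The basis `(e_A)` of the Clifford algebra. -/
def bladeBasis (𝕜 : Type) [RCLike 𝕜] (n : ℕ) : Module.Basis (Finset (Fin n)) 𝕜 (Cl 𝕜 n) :=
  basisOfTopLeSpanOfCardEqFinrank (blade 𝕜) (span_blade 𝕜 n) (card_eq_finrank 𝕜 n)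

theorem bladeBasis_apply (𝕜 : Type) [RCLike 𝕜] (n : ℕ) (A : Finset (Fin n)) :
    bladeBasis 𝕜 n A = blade 𝕜 A := by
  simp [bladeBasis]

/-- The component `a_A` of `a = ∑ a_A e_A`. -/
def comp {𝕜 : Type} [RCLike 𝕜] {n : ℕ} (a : Cl 𝕜 n) (A : Finset (Fin n)) : 𝕜 :=
  (bladeBasis 𝕜 n).repr a A

/-- The components of a Clifford number as a vector of a Euclidean (Hermitian) space. -/
def compVec (𝕜 : Type) [RCLike 𝕜] (n : ℕ) : Cl 𝕜 n ≃ₗ[𝕜] EuclideanSpace 𝕜 (Finset (Fin n)) :=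
  (bladeBasis 𝕜 n).equivFun.trans (WithLp.linearEquiv 2 𝕜 (Finset (Fin n) → 𝕜)).symm

/-- The norm `‖a‖ = (∑ |a_A|²)^{1/2}`. -/
instance instNormCl (𝕜 : Type) [RCLike 𝕜] (n : ℕ) : NormedAddCommGroup (Cl 𝕜 n) :=
  NormedAddCommGroup.induced (Cl 𝕜 n) (EuclideanSpace 𝕜 (Finset (Fin n)))
    (compVec 𝕜 n) (compVec 𝕜 n).injective

instance instNormedSpaceCl (𝕜 : Type) [RCLike 𝕜] (n : ℕ) : NormedSpace 𝕜 (Cl 𝕜 n) :=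
  NormedSpace.induced 𝕜 (Cl 𝕜 n) (EuclideanSpace 𝕜 (Finset (Fin n))) (compVec 𝕜 n)

theorem norm_eq_sqrt (𝕜 : Type) [RCLike 𝕜] (n : ℕ) (a : Cl 𝕜 n) :
    ‖a‖ = √(∑ A, ‖comp a A‖ ^ 2) :=
  EuclideanSpace.norm_eq (compVec 𝕜 n a)

/-- The conjugation, the anti-automorphism with `eᵢ ↦ -eᵢ`. -/
def conj {n : ℕ} (a : Cl ℝ n) : Cl ℝ n :=
  CliffordAlgebra.reverse (CliffordAlgebra.involute a)

/-- `e_0 = 1` and `e_1, …, e_n`. -/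
def unitVec (𝕜 : Type) [RCLike 𝕜] {n : ℕ} (i : Fin (n + 1)) : Cl 𝕜 n :=
  Fin.cases 1 (fun j => gen 𝕜 j) i

/-- The subspace `Cl_p ⊆ Cl_n` (for `p ≤ n`) spanned over a ring `K` of scalars by the `e_A` with
`A ⊆ {1, …, p}`. For `K = ℚ` and `𝕜 = ℝ` this is the rational Clifford algebra `Cl_p(ℚ)`. -/
def subCl (K 𝕜 : Type) [RCLike 𝕜] [Semiring K] (n p : ℕ) [Module K (Cl 𝕜 n)] :
    Submodule K (Cl 𝕜 n) :=
  Submodule.span K {a | ∃ A : Finset (Fin n), (∀ i ∈ A, (i : ℕ) < p) ∧ a = blade 𝕜 A}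

/-- The inclusion of `Cl_n` in its complexification. -/
def complexify {n : ℕ} (a : Cl ℝ n) : Cl ℂ n :=
  ∑ A : Finset (Fin n), ((comp a A : ℝ) : ℂ) • blade ℂ A

/-! ## Paravectors, the half-space and Möbius transformations -/

/-- The space `ℝ ⊕ ℝⁿ` of points `x = (x_0, …, x_n)`. -/
abbrev Para (n : ℕ) : Type := EuclideanSpace ℝ (Fin (n + 1))

/-- The last coordinate `x_n`. -/
def height {n : ℕ} (x : Para n) : ℝ := x (Fin.last n)

/-- The upper half-space `H⁺`. -/
def upperHalf (n : ℕ) : Set (Para n) := {x | 0 < height x}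

/-- `x_0 + x_1 e_1 + ⋯ + x_n e_n` as a Clifford number. -/
def ofPara {n : ℕ} (x : Para n) : Cl ℝ n := ∑ i, x i • unitVec ℝ i

/-- The paravector part of a Clifford number. -/
def toPara {n : ℕ} (a : Cl ℝ n) : Para n :=
  WithLp.toLp 2 (fun i => Fin.cases (comp a ∅) (fun j => comp a {j}) i)

/-- The paravectors of `ℝ ⊕ ℝ^{n-1}`, as Clifford numbers. -/
def lowPara (n : ℕ) : Set (Cl ℝ n) := ofPara '' {x : Para n | height x = 0}

/-- `ℚ ⊕ ℚⁿ` inside `Cl_n`. -/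
def ratPara (n : ℕ) : Set (Cl ℝ n) := ofPara '' {x : Para n | ∀ i, ∃ q : ℚ, x i = q}

/-- `ℚ` inside `Cl_n`. -/
def ratScalar (n : ℕ) : Set (Cl ℝ n) := Set.range (fun q : ℚ => algebraMap ℝ (Cl ℝ n) (q : ℝ))

/-- A product of finitely many paravectors of `ℝ ⊕ ℝ^{n-1}`. -/
def IsLowProd {n : ℕ} (a : Cl ℝ n) : Prop :=
  ∃ l : List (Cl ℝ n), (∀ v ∈ l, v ∈ lowPara n) ∧ l.prod = a

/-- `2 × 2` matrices over `Cl_n`. -/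
abbrev Mat (n : ℕ) : Type := Matrix (Fin 2) (Fin 2) (Cl ℝ n)

/-- The special Ahlfors-Vahlen group `SAV(ℝ ⊕ ℝ^{n-1})`. The entries are `a = M 0 0`, `b = M 0 1`,
`c = M 1 0`, `d = M 1 1`. `Ring.inverse` is the genuine inverse here, because a non-zero product
of paravectors is invertible. -/
structure IsSAV {n : ℕ} (M : Mat n) : Prop where
  prod : ∀ i j, IsLowProd (M i j)
  det : M 0 0 * CliffordAlgebra.reverse (M 1 1) - M 0 1 * CliffordAlgebra.reverse (M 1 0) = 1
  c_ne : M 1 0 ≠ 0 → M 0 0 * Ring.inverse (M 1 0) ∈ lowPara n ∧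
    Ring.inverse (M 1 0) * M 1 1 ∈ lowPara n
  c_eq : M 1 0 = 0 → M 0 1 * Ring.inverse (M 1 1) ∈ lowPara n

/-- The rational Ahlfors-Vahlen group `SAV(ℝ ⊕ ℝ^{n-1}, ℚ)`. -/
structure IsRatSAV {n : ℕ} (M : Mat n) : Prop extends IsSAV M where
  norms : ∀ i j, M i j * conj (M i j) ∈ ratScalar n
  ac : M 0 0 * conj (M 1 0) ∈ ratPara n
  bd : M 0 1 * conj (M 1 1) ∈ ratPara n
  ab : ∀ x ∈ ratPara n, M 0 0 * x * conj (M 0 1) + M 0 1 * conj x * conj (M 0 0) ∈ ratScalar n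
  cd : ∀ x ∈ ratPara n, M 1 0 * x * conj (M 1 1) + M 1 1 * conj x * conj (M 1 0) ∈ ratScalar n
  adbc : ∀ x ∈ ratPara n, M 0 0 * x * conj (M 1 1) + M 0 1 * conj x * conj (M 1 0) ∈ ratPara n

/-- `I` is a `ℤ`-order in the rational Clifford algebra `Cl_p(ℚ) ⊆ Cl_n` (`p ≤ n`): a subring of it
with finitely generated additive group that contains a `ℚ`-basis of it. -/
structure IsZOrder {n : ℕ} (p : ℕ) (I : Subring (Cl ℝ n)) : Prop where
  fg : I.toAddSubgroup.FG
  span_eq : Submodule.span ℚ (I : Set (Cl ℝ n)) = subCl ℚ ℝ n p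

/-- The group `Γ_{n-1}(I) = SAV(ℝ ⊕ ℝ^{n-1}, ℚ) ∩ Mat(2, I)`. -/
def Gam {n : ℕ} (I : Subring (Cl ℝ n)) : Set (Mat n) :=
  {M | IsRatSAV M ∧ ∀ i j, M i j ∈ I}

/-- The principal congruence subgroup `Γ_{n-1}(I)[N]`: `a - 1, b, c, d - 1 ∈ N I`. -/
def GamN {n : ℕ} (I : Subring (Cl ℝ n)) (N : ℕ) : Set (Mat n) :=
  {M | M ∈ Gam I ∧ ∀ i j, ∃ y ∈ I, (M - 1) i j = N • y}

/-- `𝓡` is a system of representatives of the right cosets `Γ_{n-1}(I)[N] R` in `Γ_{n-1}(I)`. -/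
def IsCosetSystem {n : ℕ} (I : Subring (Cl ℝ n)) (N : ℕ) (𝓡 : Set (Mat n)) : Prop :=
  𝓡 ⊆ Gam I ∧ ∀ M ∈ Gam I, ∃! R, R ∈ 𝓡 ∧ ∃ G ∈ GamN I N, M = G * R

/-- `c x + d`. -/
def denom {n : ℕ} (M : Mat n) (x : Para n) : Cl ℝ n := M 1 0 * ofPara x + M 1 1

/-- `M⟨x⟩ = (a x + b)(c x + d)⁻¹`, a paravector for `M ∈ SAV(ℝ ⊕ ℝ^{n-1})` and `x ∈ H⁺`. -/
def mobius {n : ℕ} (M : Mat n) (x : Para n) : Para n :=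
  toPara ((M 0 0 * ofPara x + M 0 1) * Ring.inverse (denom M x))

/-- `conj (c x + d) / ‖c x + d‖^{n+1-k} · f(M⟨x⟩)`. -/
def slash {n : ℕ} (k : ℤ) (f : Para n → Cl ℝ n) (M : Mat n) (x : Para n) : Cl ℝ n :=
  (‖denom M x‖ ^ ((n : ℤ) + 1 - k))⁻¹ • (conj (denom M x) * f (mobius M x))

/-! ## `k`-holomorphic Cliffordian functions and automorphic forms -/

/-- The Dirac operator `D f = ∑ eᵢ ∂f/∂xᵢ`. -/
def dirac {n : ℕ} (f : Para n → Cl ℝ n) (x : Para n) : Cl ℝ n :=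
  ∑ i : Fin (n + 1), unitVec ℝ i * fderiv ℝ f x (EuclideanSpace.single i 1)

/-- `f` is `C^{2m+1}` on the half-space and `D Δ^m f = 0` there. -/
def IsDiracPoly {n : ℕ} (m : ℕ) (f : Para n → Cl ℝ n) : Prop :=
  ContDiffOn ℝ ((2 * m + 1 : ℕ) : WithTop ℕ∞) f (upperHalf n) ∧
    ∀ x ∈ upperHalf n, dirac ((Laplacian.laplacian)^[m] f) x = 0

/-- Left `k`-holomorphic Cliffordian functions on the half-space, for even `k`: `D Δ^{k/2} f = 0`
if `k ≥ 0`, while for `k < 0` the function `x_n^{-k} f` has to be `(2-k)`-holomorphic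
Cliffordian. -/
def IsKHol {n : ℕ} (k : ℤ) (f : Para n → Cl ℝ n) : Prop :=
  if 0 ≤ k then IsDiracPoly (k / 2).toNat f
  else IsDiracPoly ((2 - k) / 2).toNat (fun x => height x ^ (-k) • f x)

/-- Left `k`-holomorphic Cliffordian automorphic forms on `Γ_{n-1}(I)[N]`. Only the values on the
half-space matter. -/
structure IsAutomorphicForm {n : ℕ} (k : ℤ) (I : Subring (Cl ℝ n)) (N : ℕ)
    (f : Para n → Cl ℝ n) : Prop where
  hol : IsKHol k f
  inv : ∀ M ∈ GamN I N, ∀ x ∈ upperHalf n, f x = slash k f M x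

/-- Left `k`-holomorphic Cliffordian cusp forms (of weight `n - k`) on `Γ_{n-1}(I)[N]`. The limit
is required for all matrices of `Γ_{n-1}(I)`, that is, for all the elements of all the systems of
representatives of its cosets modulo `Γ_{n-1}(I)[N]`. -/
structure IsCuspForm {n : ℕ} (k : ℤ) (I : Subring (Cl ℝ n)) (N : ℕ)
    (f : Para n → Cl ℝ n) : Prop extends IsAutomorphicForm k I N f where
  cusp : ∀ M ∈ Gam I, Tendsto
    (fun t : ℝ => (if 0 < k then (1 : ℝ) else t ^ (-k)) •
      slash k f M (EuclideanSpace.single (Fin.last n) t)) atTop (𝓝 0)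

/-! ## Fourier expansions -/

/-- The matrix of the translation by the Clifford number `v`. -/
def translation {n : ℕ} (v : Cl ℝ n) : Mat n := !![1, v; 0, 1]

/-- The lattice of the translations in `Γ_{n-1}(I)[N]`, inside `ℝ ⊕ ℝ^{n-1}`. -/
def lattice {n : ℕ} (I : Subring (Cl ℝ n)) (N : ℕ) : Set (Para n) :=
  {x | height x = 0 ∧ translation (ofPara x) ∈ GamN I N}

/-- The dual lattice, inside `ℝ ⊕ ℝ^{n-1}`. -/
def dualLattice {n : ℕ} (I : Subring (Cl ℝ n)) (N : ℕ) : Set (Para n) :=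
  {ω | height ω = 0 ∧ ∀ x ∈ lattice I N, ∃ m : ℤ, inner ℝ ω x = m}

/-- The modified Bessel function `K_ν(t) = ∫_0^∞ exp(-t cosh u) cosh(ν u) du`, `t > 0`. -/
def besselK (ν t : ℝ) : ℝ :=
  ∫ u in Set.Ioi (0 : ℝ), Real.exp (-t * Real.cosh u) * Real.cosh (ν * u)

/-- The Fourier image of the null frequency,
`a + α t^k + b e_n t + β e_n t^{k+1}` with `t = x_n`. -/
def nullPart {n : ℕ} (k : ℤ) (a α b β : Cl ℂ n) (t : ℝ) : Cl ℂ n :=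
  a + (t : ℂ) ^ k • α + (t : ℂ) • (b * unitVec ℂ (Fin.last n)) +
    (t : ℂ) ^ (k + 1) • (β * unitVec ℂ (Fin.last n))

/-- The term of the frequency `ω`,
`x_n^{(k+1)/2} [K_{(k+1)/2}(2π‖ω‖x_n) α + K_{(k-1)/2}(2π‖ω‖x_n) β e_n] e^{2πi⟨ω,x⟩}`. -/
def fourierTerm {n : ℕ} (k : ℤ) (α β : Cl ℂ n) (ω x : Para n) : Cl ℂ n :=
  (((height x ^ (((k : ℝ) + 1) / 2) : ℝ) : ℂ) *
      Complex.exp (2 * Real.pi * Complex.I * ((inner ℝ ω x : ℝ) : ℂ))) •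
    (((besselK (((k : ℝ) + 1) / 2) (2 * Real.pi * ‖ω‖ * height x) : ℝ) : ℂ) • α +
      ((besselK (((k : ℝ) - 1) / 2) (2 * Real.pi * ‖ω‖ * height x) : ℝ) : ℂ) •
        (β * unitVec ℂ (Fin.last n)))

/-- `F` has on the half-space the Fourier expansion with the null frequency coefficients
`a₀, α₀, b₀, β₀` and the coefficients `α ω, β ω` (`ω ≠ 0` in the dual lattice), which all
are in the complexification of `Cl_{n-1}`. -/
structure HasFourierExpansion {n : ℕ} (k : ℤ) (I : Subring (Cl ℝ n)) (N : ℕ)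
    (F : Para n → Cl ℝ n) (a₀ α₀ b₀ β₀ : Cl ℂ n) (α β : Para n → Cl ℂ n) : Prop where
  a_mem : a₀ ∈ subCl ℂ ℂ n (n - 1)
  α_mem : α₀ ∈ subCl ℂ ℂ n (n - 1)
  b_mem : b₀ ∈ subCl ℂ ℂ n (n - 1)
  β_mem : β₀ ∈ subCl ℂ ℂ n (n - 1)
  αω_mem : ∀ ω ∈ dualLattice I N, ω ≠ 0 → α ω ∈ subCl ℂ ℂ n (n - 1)
  βω_mem : ∀ ω ∈ dualLattice I N, ω ≠ 0 → β ω ∈ subCl ℂ ℂ n (n - 1)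
  hasSum : ∀ x ∈ upperHalf n,
    HasSum (fun ω : {ω : Para n // ω ∈ dualLattice I N ∧ ω ≠ 0} =>
        fourierTerm k (α ω) (β ω) ω x)
      (complexify (F x) - nullPart k a₀ α₀ b₀ β₀ (height x))

end CliffordForms

end

open CliffordForms

namespace CliffordForms

variable {n : ℕ}

/-! ## Conjugation and reversion -/

/-! Every `M` in `Γ` is `G * R` with `G ∈ Γ[N]` and `R ∈ 𝓡`. The slash operation satisfies the
cocycle relation `f|(G R) = (f|G)|R` (`slash_mul`), and `f|G = f` on the half-space, so the cusp
condition at `M` is a statement about `F(t e_n; R)` as `t → ∞`.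

Once the null frequency is gone, only frequencies `ω ≠ 0` remain. Since `cosh u ≥ 1`, the integral
for `K_ν` gives `K_ν(s + h) ≤ e^{-h} K_ν(s)` (`besselK_add_le`), so on the axis each term is at most
`t^{(k+1)/2} e^{-2π‖ω‖(t-1)}` times its own norm at `t = 1` (`norm_fourierTerm_le`). The dual
lattice has a shortest length `δ > 0` (`exists_le_norm_of_mem_dualLattice`), and the norms at `t =
1` have a finite sum `S`. Hence `‖F(t e_n; R)‖ ≤ t^{(k+1)/2} e^{-2πδ(t-1)} S`, which beats every
power of `t`.

The cocycle relation needs two facts about Clifford numbers: the norm is multiplicative on the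
denominators `c x + d` (`norm_mul_of_conj_mul_self`), and Ahlfors-Vahlen matrices preserve the
half-space (`IsSAV.exists_denom_inv`). -/

theorem conj_mul (a b : Cl ℝ n) : conj (a * b) = conj b * conj a := by
  simp [conj]

theorem conj_add (a b : Cl ℝ n) : conj (a + b) = conj a + conj b := by
  simp [conj]

theorem conj_algebraMap (r : ℝ) : conj (algebraMap ℝ (Cl ℝ n) r) = algebraMap ℝ (Cl ℝ n) r := by
  simp [conj]

theorem conj_one : conj (1 : Cl ℝ n) = 1 := by
  simp [conj]

theorem conj_ι (v : Fin n → ℝ) :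
    conj (CliffordAlgebra.ι (negSumSq ℝ n) v) = -CliffordAlgebra.ι (negSumSq ℝ n) v := by
  simp [conj]

/-! ## Components and the scalar product -/

theorem blade_empty (𝕜 : Type) [RCLike 𝕜] : blade 𝕜 (∅ : Finset (Fin n)) = 1 := by
  simp [blade, listProd]

theorem blade_singleton (𝕜 : Type) [RCLike 𝕜] (i : Fin n) : blade 𝕜 {i} = gen 𝕜 i := by
  simp [blade, listProd]

theorem comp_blade (𝕜 : Type) [RCLike 𝕜] (A B : Finset (Fin n)) :
    comp (blade 𝕜 A) B = if A = B then 1 else 0 := by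
  rw [comp, ← bladeBasis_apply, Module.Basis.repr_self, Finsupp.single_apply]

theorem comp_add {𝕜 : Type} [RCLike 𝕜] (a b : Cl 𝕜 n) (A : Finset (Fin n)) :
    comp (a + b) A = comp a A + comp b A := by
  simp [comp]

theorem comp_smul {𝕜 : Type} [RCLike 𝕜] (c : 𝕜) (a : Cl 𝕜 n) (A : Finset (Fin n)) :
    comp (c • a) A = c * comp a A := by
  simp [comp]

theorem comp_sum {𝕜 : Type} [RCLike 𝕜] {ι : Type*} (s : Finset ι) (g : ι → Cl 𝕜 n)
    (A : Finset (Fin n)) : comp (∑ i ∈ s, g i) A = ∑ i ∈ s, comp (g i) A := by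
  simp [comp, map_sum, Finsupp.finsetSum_apply]

theorem sum_comp_smul {𝕜 : Type} [RCLike 𝕜] (a : Cl 𝕜 n) : ∑ A, comp a A • blade 𝕜 A = a := by
  conv_rhs => rw [← (bladeBasis 𝕜 n).sum_repr a]
  simp [comp, bladeBasis_apply]

theorem blade_injective (𝕜 : Type) [RCLike 𝕜] :
    Function.Injective (blade 𝕜 : Finset (Fin n) → Cl 𝕜 n) := by
  intro A B h
  have h1 := comp_blade 𝕜 A B
  rw [h, comp_blade, if_pos rfl] at h1
  by_contra h2
  simp [h2] at h1

/-- The scalar product of the components. -/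
noncomputable def dot (a b : Cl ℝ n) : ℝ := ∑ A, comp a A * comp b A

theorem dot_self (a : Cl ℝ n) : dot a a = ‖a‖ ^ 2 := by
  rw [norm_eq_sqrt, Real.sq_sqrt (Finset.sum_nonneg fun _ _ => sq_nonneg _)]
  simp [dot, sq]

theorem dot_comm (a b : Cl ℝ n) : dot a b = dot b a := by
  simp [dot, mul_comm]

theorem dot_add_left (a b c : Cl ℝ n) : dot (a + b) c = dot a c + dot b c := by
  simp [dot, comp_add, add_mul, Finset.sum_add_distrib]

theorem dot_smul_left (r : ℝ) (a b : Cl ℝ n) : dot (r • a) b = r * dot a b := by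
  simp [dot, comp_smul, mul_assoc, Finset.mul_sum]

theorem dot_add_right (a b c : Cl ℝ n) : dot a (b + c) = dot a b + dot a c := by
  rw [dot_comm, dot_add_left, dot_comm b, dot_comm c]

theorem dot_smul_right (r : ℝ) (a b : Cl ℝ n) : dot a (r • b) = r * dot a b := by
  rw [dot_comm, dot_smul_left, dot_comm]

theorem dot_sum_left {ι : Type*} (s : Finset ι) (g : ι → Cl ℝ n) (b : Cl ℝ n) :
    dot (∑ i ∈ s, g i) b = ∑ i ∈ s, dot (g i) b := by
  simp only [dot, comp_sum, Finset.sum_mul]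
  exact Finset.sum_comm

theorem dot_sum_right {ι : Type*} (s : Finset ι) (g : ι → Cl ℝ n) (b : Cl ℝ n) :
    dot b (∑ i ∈ s, g i) = ∑ i ∈ s, dot b (g i) := by
  rw [dot_comm, dot_sum_left]
  simp [dot_comm b]

theorem dot_blade (A B : Finset (Fin n)) :
    dot (blade ℝ A) (blade ℝ B) = if A = B then 1 else 0 := by
  simp [dot, comp_blade]

theorem exists_gen_mul_blade (𝕜 : Type) [RCLike 𝕜] (i : Fin n) (A : Finset (Fin n)) :
    ∃ (B : Finset (Fin n)) (s : ℤˣ), gen 𝕜 i * blade 𝕜 A = s • blade 𝕜 B := by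
  obtain ⟨l, h1, -, h3⟩ :=
    gen_mul_listProd 𝕜 i (A.sort (· ≤ ·)) (Finset.sortedLT_sort A).pairwise
  rw [listProd_sorted 𝕜 l h1] at h3
  rcases h3 with h3 | h3
  · exact ⟨_, 1, h3.trans (one_smul _ _).symm⟩
  · exact ⟨_, -1, h3.trans (by rw [Units.neg_smul, one_smul])⟩

/-- Left multiplication by `e_i` permutes the orthonormal basis of blades up to sign. It sends
different blades to different blades, because its square is `-1`. -/
theorem dot_gen_mul_blade (i : Fin n) (A B : Finset (Fin n)) :
    dot (gen ℝ i * blade ℝ A) (gen ℝ i * blade ℝ B) = dot (blade ℝ A) (blade ℝ B) := by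
  obtain ⟨A', s, hs⟩ := exists_gen_mul_blade ℝ i A
  obtain ⟨B', t, ht⟩ := exists_gen_mul_blade ℝ i B
  have key (C : Finset (Fin n)) : gen ℝ i * (gen ℝ i * blade ℝ C) = -blade ℝ C := by
    rw [← mul_assoc, gen_mul_self, neg_one_mul]
  -- Excludes that two blades have opposite images under `e_i`.
  have neg_ne (C D : Finset (Fin n)) : blade ℝ C ≠ -blade ℝ D := by
    intro h
    have h1 := congrArg (fun x => comp x C) h
    simp only [← neg_one_smul ℝ (blade ℝ D), comp_smul, comp_blade, if_true] at h1
    split_ifs at h1 <;> norm_num at h1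
  by_cases hAB : A = B
  · subst hAB
    rw [hs]
    rcases Int.units_eq_one_or s with rfl | rfl
    · simp [dot_blade]
    · simp only [Units.neg_smul, one_smul, ← neg_one_smul ℝ (blade ℝ A'), dot_smul_left,
        dot_smul_right, dot_blade]
      simp
  · have hne : A' ≠ B' := by
      intro h
      have h1 := key A
      have h2 := key B
      rw [hs] at h1
      rw [ht] at h2
      subst h
      rcases Int.units_eq_one_or s with rfl | rfl <;> rcases Int.units_eq_one_or t with rfl | rfl
      · rw [h1] at h2
        exact hAB (blade_injective ℝ (neg_injective h2))
      · simp only [one_smul, Units.neg_smul, mul_neg] at h1 h2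
        rw [h1] at h2
        exact neg_ne A B (by simpa using h2)
      · simp only [one_smul, Units.neg_smul, mul_neg] at h1 h2
        rw [h2] at h1
        exact neg_ne B A (by simpa using h1)
      · rw [h1] at h2
        exact hAB (blade_injective ℝ (neg_injective h2))
    rw [hs, ht, dot_blade, if_neg hAB]
    rcases Int.units_eq_one_or s with rfl | rfl <;> rcases Int.units_eq_one_or t with rfl | rfl <;>
    simp only [one_smul, Units.neg_smul, ← neg_one_smul ℝ (blade ℝ A'),
      ← neg_one_smul ℝ (blade ℝ B'), dot_smul_left, dot_smul_right, dot_blade, if_neg hne, mul_zero]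

theorem dot_gen_mul_gen_mul (i : Fin n) (a b : Cl ℝ n) :
    dot (gen ℝ i * a) (gen ℝ i * b) = dot a b := by
  rw [← sum_comp_smul a, ← sum_comp_smul b]
  simp only [Finset.mul_sum, mul_smul_comm, dot_sum_left, dot_sum_right, dot_smul_left,
    dot_smul_right, dot_gen_mul_blade]

/-- The adjoint of the isometry `e_i` is its inverse, `-e_i`. -/
theorem dot_gen_mul (i : Fin n) (a b : Cl ℝ n) : dot (gen ℝ i * a) b = dot a (-gen ℝ i * b) := by
  rw [← dot_gen_mul_gen_mul i a, ← mul_assoc, mul_neg, gen_mul_self, neg_neg, one_mul]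

theorem ι_eq_sum (𝕜 : Type) [RCLike 𝕜] (m : Fin n → 𝕜) :
    CliffordAlgebra.ι (negSumSq 𝕜 n) m = ∑ i, m i • gen 𝕜 i := by
  conv_lhs => rw [← Finset.univ_sum_single m]
  rw [map_sum]
  refine Finset.sum_congr rfl fun i _ => ?_
  rw [gen, ← map_smul]
  congr 1
  rw [← Pi.single_smul]; simp

/-- Adjunction and conjugation are both anti-multiplicative, so the generators decide. -/
theorem dot_mul_left (c a b : Cl ℝ n) : dot (c * a) b = dot a (conj c * b) := by
  induction c using CliffordAlgebra.induction generalizing a b with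
  | algebraMap r => rw [conj_algebraMap, ← Algebra.smul_def, ← Algebra.smul_def, dot_smul_left,
      dot_smul_right]
  | ι m =>
    rw [conj_ι, ι_eq_sum, ← Finset.sum_neg_distrib, Finset.sum_mul, Finset.sum_mul, dot_sum_left,
      dot_sum_right]
    refine Finset.sum_congr rfl fun i _ => ?_
    rw [← smul_neg, smul_mul_assoc, smul_mul_assoc, dot_smul_left, dot_smul_right, dot_gen_mul]
  | mul x y hx hy => rw [mul_assoc, hx, hy, conj_mul, mul_assoc]
  | add x y hx hy => rw [add_mul, dot_add_left, hx, hy, conj_add, add_mul, dot_add_right]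

theorem norm_one_eq : ‖(1 : Cl ℝ n)‖ = 1 := by
  have h := dot_self (1 : Cl ℝ n)
  rw [← blade_empty ℝ, dot_blade, if_pos rfl] at h
  rw [← blade_empty ℝ]
  exact (pow_eq_one_iff_of_nonneg (norm_nonneg _) two_ne_zero).1 h.symm

/-- By adjunction `‖a c‖² = ⟨c, conj a · a c⟩ = r ‖c‖²`, and `c = 1` identifies `r` as `‖a‖²`. The
norm of `Cl_n` is not multiplicative in general. -/
theorem norm_mul_of_conj_mul_self {a : Cl ℝ n} {r : ℝ}
    (ha : conj a * a = algebraMap ℝ (Cl ℝ n) r) (b : Cl ℝ n) : ‖a * b‖ = ‖a‖ * ‖b‖ := by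
  have key (c : Cl ℝ n) : ‖a * c‖ ^ 2 = r * ‖c‖ ^ 2 := by
    rw [← dot_self, dot_mul_left, ← mul_assoc, ha, ← Algebra.smul_def, dot_smul_right, dot_self]
  have h1 := key 1
  rw [mul_one, norm_one_eq, one_pow, mul_one] at h1
  have h2 := key b
  rw [← h1, ← mul_pow] at h2
  exact (pow_left_inj₀ (norm_nonneg _) (by positivity) two_ne_zero).1 h2

/-! ## Paravectors -/

theorem ofPara_eq (x : Para n) : ofPara x =
    algebraMap ℝ (Cl ℝ n) (x 0) + CliffordAlgebra.ι (negSumSq ℝ n) (fun j => x j.succ) := by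
  rw [ofPara, Fin.sum_univ_succ, ι_eq_sum, Algebra.algebraMap_eq_smul_one]
  rfl

theorem ofPara_add (x y : Para n) : ofPara (x + y) = ofPara x + ofPara y := by
  simp [ofPara, add_smul, Finset.sum_add_distrib]

theorem ofPara_smul (r : ℝ) (x : Para n) : ofPara (r • x) = r • ofPara x := by
  simp [ofPara, mul_smul, Finset.smul_sum]

theorem ofPara_neg (x : Para n) : ofPara (-x) = -ofPara x := by
  rw [← neg_one_smul ℝ x, ofPara_smul, neg_one_smul]

theorem ofPara_zero : ofPara (0 : Para n) = 0 := by
  simp [ofPara]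

theorem toPara_ofPara (x : Para n) : toPara (ofPara x) = x := by
  ext i
  rw [toPara, ofPara, Fin.sum_univ_succ]
  have h0 : unitVec ℝ (0 : Fin (n + 1)) = blade ℝ (∅ : Finset (Fin n)) := (blade_empty ℝ).symm
  have h1 (j : Fin n) : unitVec ℝ j.succ = blade ℝ {j} := (blade_singleton ℝ j).symm
  refine Fin.cases ?_ (fun j => ?_) i
  · simp [h0, h1, comp_add, comp_sum, comp_smul, comp_blade]
  · simp [h0, h1, comp_add, comp_sum, comp_smul, comp_blade]

theorem reverse_ofPara (x : Para n) : CliffordAlgebra.reverse (ofPara x) = ofPara x := by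
  simp [ofPara_eq]

/-- The conjugate of a paravector. -/
noncomputable def paraConj (x : Para n) : Para n :=
  WithLp.toLp 2 (fun i => if i = 0 then x i else -x i)

theorem conj_ofPara (x : Para n) : conj (ofPara x) = ofPara (paraConj x) := by
  rw [ofPara_eq, ofPara_eq, conj_add, conj_algebraMap, conj_ι, ← map_neg]
  congr 2

theorem paraConj_paraConj (x : Para n) : paraConj (paraConj x) = x := by
  ext i
  by_cases h : i = 0 <;> simp [paraConj, h]

theorem height_paraConj (hn : 1 ≤ n) (x : Para n) : height (paraConj x) = -height x := by
  have : Fin.last n ≠ 0 := by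
    rw [Ne, Fin.ext_iff]; simp; omega
  simp [height, paraConj, this]

theorem height_add (x y : Para n) : height (x + y) = height x + height y := rfl

theorem height_smul (r : ℝ) (x : Para n) : height (r • x) = r * height x := rfl

theorem norm_paraConj (x : Para n) : ‖paraConj x‖ = ‖x‖ := by
  rw [EuclideanSpace.norm_eq, EuclideanSpace.norm_eq]
  congr 1
  refine Finset.sum_congr rfl fun i _ => ?_
  by_cases h : i = 0 <;> simp [paraConj, h]

theorem ofPara_mul_conj (x : Para n) :
    ofPara x * conj (ofPara x) = algebraMap ℝ (Cl ℝ n) (‖x‖ ^ 2) := by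
  have h : CliffordAlgebra.ι (negSumSq ℝ n) (fun j => x j.succ) *
      CliffordAlgebra.ι (negSumSq ℝ n) (fun j => x j.succ) =
      -algebraMap ℝ (Cl ℝ n) (∑ j : Fin n, x j.succ ^ 2) := by
    rw [CliffordAlgebra.ι_sq_scalar, ← map_neg]
    congr 1
    simp [negSumSq, QuadraticMap.weightedSumSquares_apply, sq]
  rw [ofPara_eq, conj_add, conj_algebraMap, conj_ι, EuclideanSpace.norm_sq_eq, Fin.sum_univ_succ,
    add_mul, mul_add, mul_add, mul_neg, mul_neg, h, Algebra.commutes (x 0) (CliffordAlgebra.ι (negSumSq ℝ n) _), map_add]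
  simp only [Real.norm_eq_abs, sq_abs, neg_neg]
  rw [sq, map_mul]
  abel

theorem conj_mul_ofPara (x : Para n) :
    conj (ofPara x) * ofPara x = algebraMap ℝ (Cl ℝ n) (‖x‖ ^ 2) := by
  have h := ofPara_mul_conj (paraConj x)
  rwa [conj_ofPara, paraConj_paraConj, ← conj_ofPara, norm_paraConj] at h

theorem exists_ofPara_mul_add_conj (x y : Para n) :
    ∃ r : ℝ, ofPara x * ofPara y + conj (ofPara y) * conj (ofPara x) = algebraMap ℝ (Cl ℝ n) r := by
  -- Polarization of `z · conj z = ‖z‖²` at `x` and `conj y`.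
  refine ⟨‖x + paraConj y‖ ^ 2 - ‖x‖ ^ 2 - ‖y‖ ^ 2, ?_⟩
  rw [map_sub, map_sub, ← ofPara_mul_conj, ← ofPara_mul_conj x, ← conj_mul_ofPara y, ofPara_add,
    conj_add, ← conj_ofPara]
  have : conj (conj (ofPara y)) = ofPara y := by
    rw [conj_ofPara, conj_ofPara, paraConj_paraConj]
  rw [this]
  noncomm_ring

/-- `v x v = v (x v + conj v · conj x) - v conj v · conj x = r v - ‖v‖² conj x` with `r` real. The
first term has height `0`, and conjugation changes the sign of the height because `n ≥ 1`. -/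
theorem exists_ofPara_sandwich (hn : 1 ≤ n) (v x : Para n) (hv : height v = 0) :
    ∃ y : Para n, ofPara v * ofPara x * ofPara v = ofPara y ∧ height y = ‖v‖ ^ 2 * height x := by
  obtain ⟨r, hr⟩ := exists_ofPara_mul_add_conj x v
  refine ⟨r • v + (-‖v‖ ^ 2) • paraConj x, ?_, ?_⟩
  · rw [ofPara_add, ofPara_smul, ofPara_smul, ← conj_ofPara, Algebra.smul_def,
      Algebra.commutes, ← hr, neg_smul, Algebra.smul_def, ← ofPara_mul_conj]
    noncomm_ring
  · rw [height_add, height_smul, height_smul, hv, height_paraConj hn]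
    ring

/-! ## Products of paravectors -/

theorem IsLowProd.one : IsLowProd (1 : Cl ℝ n) := ⟨[], by simp, by simp⟩

theorem IsLowProd.of_mem {a : Cl ℝ n} (h : a ∈ lowPara n) : IsLowProd a :=
  ⟨[a], by simpa using h, by simp⟩

theorem IsLowProd.mul {a b : Cl ℝ n} (ha : IsLowProd a) (hb : IsLowProd b) :
    IsLowProd (a * b) := by
  obtain ⟨l, hl, rfl⟩ := ha
  obtain ⟨m, hm, rfl⟩ := hb
  refine ⟨l ++ m, fun v hv => ?_, List.prod_append⟩
  rcases List.mem_append.1 hv with h | h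
  exacts [hl v h, hm v h]

/-- Induction on the number of factors of a product of paravectors of `ℝ ⊕ ℝ^{n-1}`. -/
theorem IsLowProd.rec_mul {P : (a : Cl ℝ n) → IsLowProd a → Prop} (one : P 1 .one)
    (mul : ∀ v a (hv : height v = 0) (ha : IsLowProd a), P a ha →
      P (ofPara v * a) (.mul (.of_mem ⟨v, hv, rfl⟩) ha)) {a : Cl ℝ n}
    (ha : IsLowProd a) : P a ha := by
  obtain ⟨l, hl, rfl⟩ := ha
  induction l with
  | nil => exact one
  | cons v t ih =>
    obtain ⟨x, hx, rfl⟩ := hl v (by simp)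
    have ht : ∀ w ∈ t, w ∈ lowPara n := fun w hw => hl w (by simp [hw])
    exact mul x _ hx ⟨t, ht, rfl⟩ (ih ht)

/-- The inverse of a non-zero paravector. -/
noncomputable def paraInv (x : Para n) : Para n := (‖x‖ ^ 2)⁻¹ • paraConj x

theorem ofPara_mul_paraInv {x : Para n} (hx : x ≠ 0) : ofPara x * ofPara (paraInv x) = 1 := by
  have : ‖x‖ ^ 2 ≠ 0 := by simpa using hx
  rw [paraInv, ofPara_smul, mul_smul_comm, ← conj_ofPara, ofPara_mul_conj,
    Algebra.algebraMap_eq_smul_one, smul_smul, inv_mul_cancel₀ this, one_smul]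

theorem paraInv_mul_ofPara {x : Para n} (hx : x ≠ 0) : ofPara (paraInv x) * ofPara x = 1 := by
  have : ‖x‖ ^ 2 ≠ 0 := by simpa using hx
  rw [paraInv, ofPara_smul, smul_mul_assoc, ← conj_ofPara, conj_mul_ofPara,
    Algebra.algebraMap_eq_smul_one, smul_smul, inv_mul_cancel₀ this, one_smul]

theorem height_paraInv (hn : 1 ≤ n) (x : Para n) :
    height (paraInv x) = -((‖x‖ ^ 2)⁻¹ * height x) := by
  rw [paraInv, height_smul, height_paraConj hn, mul_neg]

theorem IsLowProd.exists_inv (hn : 1 ≤ n) {a : Cl ℝ n} (ha : IsLowProd a) :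
    a ≠ 0 → ∃ u, IsLowProd u ∧ a * u = 1 ∧ u * a = 1 := by
  induction ha using IsLowProd.rec_mul with
  | one => exact fun _ => ⟨1, .one, by simp, by simp⟩
  | mul v a hv _ ih =>
    intro h
    obtain ⟨u, hu, h1, h2⟩ := ih (right_ne_zero_of_mul h)
    have hv0 : v ≠ 0 := by
      rintro rfl
      simp [ofPara_zero] at h
    refine ⟨u * ofPara (paraInv v), hu.mul (.of_mem ⟨_, ?_, rfl⟩), ?_, ?_⟩
    · simp [height_paraInv hn, hv]
    · rw [mul_assoc, ← mul_assoc a, h1, one_mul, ofPara_mul_paraInv hv0]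
    · rw [mul_assoc, ← mul_assoc (ofPara (paraInv v)), paraInv_mul_ofPara hv0, one_mul, h2]

theorem IsLowProd.conj_mul_self {a : Cl ℝ n} (ha : IsLowProd a) :
    ∃ r : ℝ, conj a * a = algebraMap ℝ (Cl ℝ n) r := by
  induction ha using IsLowProd.rec_mul with
  | one => exact ⟨1, by simp [conj_one]⟩
  | mul v a hv _ ih =>
    obtain ⟨r, hr⟩ := ih
    refine ⟨‖v‖ ^ 2 * r, ?_⟩
    rw [conj_mul, mul_assoc, ← mul_assoc _ _ a, conj_mul_ofPara, Algebra.left_comm, hr, map_mul]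

/-- The factors are peeled off from the left: for `v a` the sandwich of `x` is the sandwich by `a`
of the paravector `v x v`. -/
theorem IsLowProd.sandwich (hn : 1 ≤ n) {a : Cl ℝ n} (ha : IsLowProd a) :
    a ≠ 0 → ∀ x : Para n, ∃ y : Para n, CliffordAlgebra.reverse a * ofPara x * a = ofPara y ∧
      ∃ r : ℝ, 0 < r ∧ height y = r * height x := by
  induction ha using IsLowProd.rec_mul with
  | one => exact fun _ x => ⟨x, by simp, 1, one_pos, by simp⟩
  | mul v a hv _ ih =>
    intro h x
    have hv0 : v ≠ 0 := by
      rintro rfl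
      simp [ofPara_zero] at h
    obtain ⟨y, hy, hy'⟩ := exists_ofPara_sandwich hn v x hv
    obtain ⟨z, hz, r, hr, hr'⟩ := ih (right_ne_zero_of_mul h) y
    refine ⟨z, ?_, r * ‖v‖ ^ 2, by positivity, ?_⟩
    · rw [← hz, ← hy, CliffordAlgebra.reverse.map_mul, reverse_ofPara]
      simp only [mul_assoc]
    · rw [hr', hy', mul_assoc]

theorem ringInverse_eq {a u : Cl ℝ n} (h1 : a * u = 1) (h2 : u * a = 1) : Ring.inverse a = u :=
  Ring.inverse_unit ⟨a, u, h1, h2⟩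

/-! ## Ahlfors-Vahlen matrices acting on the half-space -/

theorem mem_upperHalf {x : Para n} : x ∈ upperHalf n ↔ 0 < height x := Iff.rfl

theorem ne_zero_of_mem_upperHalf {x : Para n} (hx : x ∈ upperHalf n) : x ≠ 0 := by
  rintro rfl
  exact lt_irrefl (0 : ℝ) hx

/-- The denominator at a point of the half-space is a similitude with a two-sided inverse `u`, and
the Möbius transformation maps the point to a point of the half-space. -/
theorem IsSAV.exists_denom_inv (hn : 1 ≤ n) {M : Mat n} (hM : IsSAV M) {x : Para n}
    (hx : x ∈ upperHalf n) :
    ∃ u, denom M x * u = 1 ∧ u * denom M x = 1 ∧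
      (∃ r : ℝ, conj (denom M x) * denom M x = algebraMap ℝ (Cl ℝ n) r) ∧
      ∃ y ∈ upperHalf n, (M 0 0 * ofPara x + M 0 1) * u = ofPara y := by
  have : Nontrivial (Cl ℝ n) := ⟨1, 0, fun h => by simpa [h] using norm_one_eq (n := n)⟩
  by_cases hc : M 1 0 = 0
  · have hdet := hM.det
    rw [hc, map_zero, mul_zero, sub_zero] at hdet
    have hd : M 1 1 ≠ 0 := by
      intro h
      simp [h] at hdet
    obtain ⟨u, hu, h1, h2⟩ := (hM.prod 1 1).exists_inv hn hd
    have hu0 : u ≠ 0 := right_ne_zero_of_mul (h1.trans_ne one_ne_zero)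
    obtain ⟨w, hw, hw'⟩ := hM.c_eq hc
    rw [ringInverse_eq h1 h2] at hw'
    -- With `c = 0` and `u = d⁻¹`, the determinant gives `a = reverse u`, so that `M⟨x⟩ = reverse u
    -- · x · u + b d⁻¹`.
    have ha : M 0 0 = CliffordAlgebra.reverse u := by
      have h3 := congrArg CliffordAlgebra.reverse h2
      rw [CliffordAlgebra.reverse.map_mul, CliffordAlgebra.reverse.map_one] at h3
      exact left_inv_eq_right_inv hdet h3
    obtain ⟨y, hy, r, hr, hr'⟩ := hu.sandwich hn hu0 x
    have hden : denom M x = M 1 1 := by rw [denom, hc, zero_mul, zero_add]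
    rw [hden]
    refine ⟨u, h1, h2, (hM.prod 1 1).conj_mul_self, y + w, ?_, ?_⟩
    · have hw0 : height w = 0 := hw
      have hx0 : 0 < height x := hx
      rw [mem_upperHalf, height_add, hr', hw0, add_zero]
      positivity
    · rw [add_mul, ofPara_add, ha, hy, hw']
  · obtain ⟨u, hu, h1, h2⟩ := (hM.prod 1 0).exists_inv hn hc
    have hu0 : u ≠ 0 := right_ne_zero_of_mul (h1.trans_ne one_ne_zero)
    obtain ⟨⟨v, hv, hv'⟩, ⟨w, hw, hw'⟩⟩ := hM.c_ne hc
    rw [ringInverse_eq h1 h2] at hv' hw'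
    have hv0 : height v = 0 := hv
    have hw0 : height w = 0 := hw
    have hx0 : 0 < height x := hx
    have hz : x + w ∈ upperHalf n := by
      rwa [mem_upperHalf, height_add, hw0, add_zero]
    have hz0 := ne_zero_of_mem_upperHalf hz
    have hd : M 1 1 = M 1 0 * ofPara w := by rw [hw', ← mul_assoc, h1, one_mul]
    have hden : denom M x = M 1 0 * ofPara (x + w) := by
      rw [denom, ofPara_add, mul_add, ← hd]
    -- Now `u = c⁻¹` and `w = c⁻¹ d`. The determinant reads `(a w - b) · reverse c = 1`, whence
    -- `M⟨x⟩ = a c⁻¹ - reverse u · (x + w)⁻¹ · u`.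
    have hb : M 0 1 = M 0 0 * ofPara w - CliffordAlgebra.reverse u := by
      have h3 := congrArg CliffordAlgebra.reverse h2
      rw [CliffordAlgebra.reverse.map_mul, CliffordAlgebra.reverse.map_one] at h3
      have h4 := hM.det
      rw [hd, CliffordAlgebra.reverse.map_mul, reverse_ofPara, ← mul_assoc, ← sub_mul] at h4
      have h5 : M 0 0 * ofPara w - M 0 1 = CliffordAlgebra.reverse u :=
        left_inv_eq_right_inv h4 h3
      rw [← h5]
      abel
    -- Inversion reverses the sign of the height, so `-(x + w)⁻¹` is again in the half-space.
    obtain ⟨y, hy, r, hr, hr'⟩ := hu.sandwich hn hu0 (-paraInv (x + w))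
    rw [hden]
    refine ⟨ofPara (paraInv (x + w)) * u, ?_, ?_, ?_, y + v, ?_, ?_⟩
    · rw [mul_assoc, ← mul_assoc (ofPara (x + w)), ofPara_mul_paraInv hz0, one_mul, h1]
    · rw [mul_assoc, ← mul_assoc u, h2, one_mul, paraInv_mul_ofPara hz0]
    · obtain ⟨s, hs⟩ := (hM.prod 1 0).conj_mul_self
      refine ⟨s * ‖x + w‖ ^ 2, ?_⟩
      rw [conj_mul, mul_assoc, ← mul_assoc (conj (M 1 0)), hs, Algebra.left_comm, conj_mul_ofPara,
        map_mul]
    · have hxw : height (x + w) = height x := by rw [height_add, hw0, add_zero]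
      have h6 : height (-paraInv (x + w)) = (‖x + w‖ ^ 2)⁻¹ * height x := by
        rw [← neg_one_smul ℝ (paraInv (x + w)), height_smul, height_paraInv hn, hxw]
        ring
      rw [mem_upperHalf, height_add, hr', hv0, add_zero, h6]
      have : 0 < ‖x + w‖ := norm_pos_iff.2 hz0
      positivity
    · have h7 : M 0 0 * ofPara x + M 0 1 =
          M 0 0 * ofPara (x + w) - CliffordAlgebra.reverse u := by
        rw [hb, ofPara_add]
        noncomm_ring
      rw [h7, sub_mul, ofPara_add y v, hv', ← hy, ofPara_neg, mul_assoc (M 0 0),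
        ← mul_assoc (ofPara (x + w)), ofPara_mul_paraInv hz0, one_mul]
      noncomm_ring

theorem IsSAV.mobius_mem (hn : 1 ≤ n) {M : Mat n} (hM : IsSAV M) {x : Para n}
    (hx : x ∈ upperHalf n) : mobius M x ∈ upperHalf n := by
  obtain ⟨u, h1, h2, -, y, hy, h3⟩ := hM.exists_denom_inv hn hx
  rwa [mobius, ringInverse_eq h1 h2, h3, toPara_ofPara]

theorem IsSAV.ofPara_mobius_mul_denom (hn : 1 ≤ n) {M : Mat n} (hM : IsSAV M) {x : Para n}
    (hx : x ∈ upperHalf n) :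
    ofPara (mobius M x) * denom M x = M 0 0 * ofPara x + M 0 1 := by
  obtain ⟨u, h1, h2, -, y, hy, h3⟩ := hM.exists_denom_inv hn hx
  rw [mobius, ringInverse_eq h1 h2, h3, toPara_ofPara, ← h3, mul_assoc, h2, mul_one]

/-! ### The cocycle relation and the slash operation -/

/-- The column `(a x + b, c x + d)` of `R` equals `(R⟨x⟩, 1)` times the denominator on the right.
Row `0` serves `mobius_mul`, row `1` serves `denom_mul`. -/
theorem mul_linear_eq (G R : Mat n) (i : Fin 2) (hn : 1 ≤ n) (hR : IsSAV R) {x : Para n}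
    (hx : x ∈ upperHalf n) :
    (G * R) i 0 * ofPara x + (G * R) i 1 =
      (G i 0 * ofPara (mobius R x) + G i 1) * denom R x := by
  rw [add_mul, mul_assoc, hR.ofPara_mobius_mul_denom hn hx, denom, Matrix.mul_apply,
    Matrix.mul_apply]
  simp only [Fin.sum_univ_two]
  noncomm_ring

theorem denom_mul (hn : 1 ≤ n) (G : Mat n) {R : Mat n} (hR : IsSAV R) {x : Para n}
    (hx : x ∈ upperHalf n) : denom (G * R) x = denom G (mobius R x) * denom R x :=
  mul_linear_eq G R 1 hn hR hx

theorem mobius_mul (hn : 1 ≤ n) {G R : Mat n} (hG : IsSAV G) (hR : IsSAV R) {x : Para n}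
    (hx : x ∈ upperHalf n) : mobius (G * R) x = mobius G (mobius R x) := by
  obtain ⟨u, h1, h2, -⟩ := hR.exists_denom_inv hn hx
  obtain ⟨v, h3, h4, -⟩ := hG.exists_denom_inv hn (hR.mobius_mem hn hx)
  have h5 : Ring.inverse (denom (G * R) x) = u * v := by
    rw [denom_mul hn G hR hx]
    refine ringInverse_eq ?_ ?_
    · rw [mul_assoc, ← mul_assoc (denom R x), h1, one_mul, h3]
    · rw [mul_assoc, ← mul_assoc v, h4, one_mul, h2]
  have h6 : mobius (G * R) x = toPara ((G 0 0 * ofPara (mobius R x) + G 0 1) * v) := by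
    rw [mobius, h5, mul_linear_eq G R 0 hn hR hx, mul_assoc, ← mul_assoc (denom R x), h1, one_mul]
  rw [h6, ← ringInverse_eq h3 h4]
  rfl

theorem slash_mul (hn : 1 ≤ n) (k : ℤ) (f : Para n → Cl ℝ n) {G R : Mat n} (hG : IsSAV G)
    (hR : IsSAV R) {x : Para n} (hx : x ∈ upperHalf n) :
    slash k f (G * R) x = slash k (slash k f G) R x := by
  obtain ⟨-, -, -, ⟨r, hr⟩, -⟩ := hG.exists_denom_inv hn (hR.mobius_mem hn hx)
  rw [slash, slash, slash, mobius_mul hn hG hR hx, denom_mul hn G hR hx,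
    norm_mul_of_conj_mul_self hr, conj_mul, mul_zpow, mul_inv, mul_smul_comm, smul_smul, mul_assoc,
    mul_comm (‖denom R x‖ ^ _)⁻¹]

theorem slash_congr (hn : 1 ≤ n) (k : ℤ) {f g : Para n → Cl ℝ n} (h : Set.EqOn f g (upperHalf n))
    {R : Mat n} (hR : IsSAV R) {x : Para n} (hx : x ∈ upperHalf n) :
    slash k f R x = slash k g R x := by
  rw [slash, slash, h (hR.mobius_mem hn hx)]

/-! ## The translation lattice and its dual -/

/-- Clearing of denominators. It makes multiples of `1, e_1, …, e_{n-1}` available as translations.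
-/
theorem exists_nsmul_mem_of_mem_span (I : Subring (Cl ℝ n)) {a : Cl ℝ n}
    (ha : a ∈ Submodule.span ℚ (I : Set (Cl ℝ n))) : ∃ m : ℕ, 0 < m ∧ m • a ∈ I := by
  induction ha using Submodule.span_induction with
  | mem a ha => exact ⟨1, one_pos, by simpa using ha⟩
  | zero => exact ⟨1, one_pos, by simp [I.zero_mem]⟩
  | add a b _ _ ha hb =>
    obtain ⟨l, hl, hl'⟩ := ha
    obtain ⟨m, hm, hm'⟩ := hb
    refine ⟨l * m, Nat.mul_pos hl hm, ?_⟩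
    rw [smul_add]
    refine I.add_mem ?_ ?_
    · rw [mul_comm, mul_smul]
      exact nsmul_mem hl' m
    · rw [mul_smul]
      exact nsmul_mem hm' l
  | smul q a _ ha =>
    obtain ⟨m, hm, hm'⟩ := ha
    refine ⟨q.den * m, Nat.mul_pos q.den_pos hm, ?_⟩
    have h : (q.den * m) • q • a = q.num • m • a := by
      rw [← Nat.cast_smul_eq_nsmul ℚ, ← Nat.cast_smul_eq_nsmul ℚ, ← Int.cast_smul_eq_zsmul ℚ,
        smul_smul, smul_smul, Nat.cast_mul]
      congr 1
      rw [mul_right_comm, Rat.den_mul_eq_num]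
    rw [h]
    exact zsmul_mem hm' _

theorem unitVec_mem_subCl {p : ℕ} (hp : n ≤ p + 1) {i : Fin (n + 1)} (hi : i ≠ Fin.last n) :
    unitVec ℝ i ∈ subCl ℚ ℝ n p := by
  refine Submodule.subset_span ?_
  revert hi
  refine Fin.cases (fun _ => ?_) (fun j hj => ?_) i
  · exact ⟨∅, by simp, (blade_empty ℝ).symm⟩
  · refine ⟨{j}, fun l hl => ?_, (blade_singleton ℝ j).symm⟩
    rw [Finset.mem_singleton.1 hl]
    rw [Ne, Fin.ext_iff] at hj
    simp only [Fin.val_succ, Fin.val_last] at hj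
    omega

theorem add_mem_ratPara {a b : Cl ℝ n} (ha : a ∈ ratPara n) (hb : b ∈ ratPara n) :
    a + b ∈ ratPara n := by
  obtain ⟨x, hx, rfl⟩ := ha
  obtain ⟨y, hy, rfl⟩ := hb
  refine ⟨x + y, fun i => ?_, ofPara_add x y⟩
  obtain ⟨q, hq⟩ := hx i
  obtain ⟨r, hr⟩ := hy i
  exact ⟨q + r, by simp [hq, hr]⟩

theorem zero_mem_ratPara : (0 : Cl ℝ n) ∈ ratPara n :=
  ⟨0, fun _ => ⟨0, by simp⟩, ofPara_zero⟩

theorem mul_conj_mem_ratScalar {a : Cl ℝ n} (ha : a ∈ ratPara n) : a * conj a ∈ ratScalar n := by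
  obtain ⟨x, hx, rfl⟩ := ha
  choose q hq using hx
  refine ⟨∑ i, q i ^ 2, ?_⟩
  simp only [ofPara_mul_conj, EuclideanSpace.norm_sq_eq, hq, Real.norm_eq_abs, sq_abs]
  push_cast
  rfl

theorem sub_mem_ratScalar {a b : Cl ℝ n} (ha : a ∈ ratScalar n) (hb : b ∈ ratScalar n) :
    a - b ∈ ratScalar n := by
  obtain ⟨q, rfl⟩ := ha
  obtain ⟨r, rfl⟩ := hb
  exact ⟨q - r, by simp⟩

/-- Polarization of `mul_conj_mem_ratScalar`. -/
theorem mul_conj_add_mem_ratScalar {a b : Cl ℝ n} (ha : a ∈ ratPara n) (hb : b ∈ ratPara n) :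
    a * conj b + b * conj a ∈ ratScalar n := by
  have h := sub_mem_ratScalar (sub_mem_ratScalar (mul_conj_mem_ratScalar (add_mem_ratPara ha hb))
    (mul_conj_mem_ratScalar ha)) (mul_conj_mem_ratScalar hb)
  rw [conj_add] at h
  convert h using 1
  noncomm_ring

theorem conj_zero : conj (0 : Cl ℝ n) = 0 := by
  simp [conj]

theorem isRatSAV_translation {x : Para n} (h0 : height x = 0) (hx : ofPara x ∈ ratPara n) :
    IsRatSAV (translation (ofPara x)) := by
  have hz : IsLowProd (0 : Cl ℝ n) := .of_mem ⟨0, rfl, ofPara_zero⟩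
  have hv : ofPara x ∈ lowPara n := ⟨x, h0, rfl⟩
  have r0 : (0 : Cl ℝ n) ∈ ratScalar n := ⟨0, by simp⟩
  have r1 : (1 : Cl ℝ n) ∈ ratScalar n := ⟨1, by simp⟩
  refine { prod := ?_, det := ?_, c_ne := ?_, c_eq := ?_, norms := ?_, ac := ?_, bd := ?_,
           ab := ?_, cd := ?_, adbc := ?_ }
  · intro i j
    fin_cases i <;> fin_cases j
    exacts [.one, .of_mem hv, hz, .one]
  · simp [translation]
  · intro h
    simp [translation] at h
  · intro _
    simpa [translation] using hv
  · intro i j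
    fin_cases i <;> fin_cases j
    · simpa [translation, conj_one] using r1
    · simpa [translation] using mul_conj_mem_ratScalar hx
    · simpa [translation, conj_one] using r0
    · simpa [translation, conj_one] using r1
  · simpa [translation, conj_zero] using zero_mem_ratPara
  · simpa [translation, conj_one] using hx
  · intro y hy
    simpa [translation, conj_one] using mul_conj_add_mem_ratScalar hy hx
  · intro y hy
    simpa [translation, conj_zero] using r0
  · intro y hy
    simpa [translation, conj_zero, conj_one] using hy

theorem single_mem_lattice (I : Subring (Cl ℝ n)) (N m : ℕ) {i : Fin (n + 1)}
    (hi : i ≠ Fin.last n) (hm : m • unitVec ℝ i ∈ I) :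
    EuclideanSpace.single i ((N * m : ℕ) : ℝ) ∈ lattice I N := by
  have h0 : height (EuclideanSpace.single i ((N * m : ℕ) : ℝ) : Para n) = 0 := by
    simp [height, hi.symm]
  have hx : ofPara (EuclideanSpace.single i ((N * m : ℕ) : ℝ) : Para n) =
      N • m • unitVec ℝ i := by
    rw [← mul_smul, ← Nat.cast_smul_eq_nsmul ℝ, ofPara, Finset.sum_eq_single i]
    · simp
    · intro j _ hj
      simp [hj]
    · simp
  have hr : ofPara (EuclideanSpace.single i ((N * m : ℕ) : ℝ) : Para n) ∈ ratPara n := by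
    refine ⟨_, fun j => ?_, rfl⟩
    by_cases hj : j = i
    · exact ⟨(N * m : ℕ), by simp [hj]⟩
    · exact ⟨0, by simp [hj]⟩
  generalize (EuclideanSpace.single i ((N * m : ℕ) : ℝ) : Para n) = x at h0 hx hr
  refine ⟨h0, ⟨isRatSAV_translation h0 hr, ?_⟩, ?_⟩
  · intro j l
    fin_cases j <;> fin_cases l
    · exact I.one_mem
    · exact (hx ▸ nsmul_mem hm N : ofPara x ∈ I)
    · exact I.zero_mem
    · exact I.one_mem
  · intro j l
    fin_cases j <;> fin_cases l
    · exact ⟨0, I.zero_mem, by simp [translation]⟩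
    · exact ⟨_, hm, by simp [translation, hx]⟩
    · exact ⟨0, I.zero_mem, by simp [translation]⟩
    · exact ⟨0, I.zero_mem, by simp [translation]⟩

/-- The lattice contains `N m_i e_i` for each `i < n`. Pairing `ω` with it yields the integer `N m_i
ω_i`, which has absolute value at least `1` when `ω_i ≠ 0`. -/
theorem exists_le_norm_of_mem_dualLattice {p : ℕ} (hp : n ≤ p + 1) {I : Subring (Cl ℝ n)}
    (hI : IsZOrder p I) {N : ℕ} (hN : 1 ≤ N) :
    ∃ δ : ℝ, 0 < δ ∧ ∀ ω ∈ dualLattice I N, ω ≠ 0 → δ ≤ ‖ω‖ := by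
  have h (i : Fin (n + 1)) : ∃ m : ℕ, 0 < m ∧ (i ≠ Fin.last n → m • unitVec ℝ i ∈ I) := by
    by_cases hi : i = Fin.last n
    · exact ⟨1, one_pos, fun h => (h hi).elim⟩
    · obtain ⟨m, h1, h2⟩ :=
        exists_nsmul_mem_of_mem_span I (hI.span_eq ▸ unitVec_mem_subCl hp hi)
      exact ⟨m, h1, fun _ => h2⟩
  choose m hm0 hm using h
  have hprod : 0 < N * ∏ i, m i := Nat.mul_pos hN (Finset.prod_pos fun i _ => hm0 i)
  -- The product of all `m i` gives a bound that does not depend on which coordinate of `ω` is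
  -- non-zero.
  refine ⟨((N * ∏ i, m i : ℕ) : ℝ)⁻¹, by positivity, ?_⟩
  rintro ω ⟨hω, hω'⟩ hne
  obtain ⟨i, hi⟩ : ∃ i, ω i ≠ 0 := by
    by_contra! h
    exact hne (by ext i; simpa using h i)
  have hil : i ≠ Fin.last n := by
    rintro rfl
    exact hi hω
  obtain ⟨z, hz⟩ := hω' _ (single_mem_lattice I N (m i) hil (hm i hil))
  have hz' : ((N * m i : ℕ) : ℝ) * ω i = z := by
    rw [EuclideanSpace.inner_single_right] at hz
    simpa using hz
  have hpos : (0 : ℝ) < ((N * m i : ℕ) : ℝ) := by exact_mod_cast Nat.mul_pos hN (hm0 i)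
  have hz0 : z ≠ 0 := by
    rintro rfl
    rw [Int.cast_zero, mul_eq_zero] at hz'
    exact hz'.elim hpos.ne' hi
  have h1 : (1 : ℝ) ≤ ((N * m i : ℕ) : ℝ) * |ω i| := by
    rw [← abs_of_pos hpos, ← abs_mul, hz', ← Int.cast_abs]
    exact_mod_cast Int.one_le_abs hz0
  have h2 : ((N * m i : ℕ) : ℝ) ≤ ((N * ∏ i, m i : ℕ) : ℝ) := by
    exact_mod_cast Nat.mul_le_mul_left N (Nat.le_of_dvd (Finset.prod_pos fun i _ => hm0 i)
      (Finset.dvd_prod_of_mem m (Finset.mem_univ i)))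
  have h3 : |ω i| ≤ ‖ω‖ := PiLp.norm_apply_le ω i
  rw [inv_le_iff_one_le_mul₀' (by exact_mod_cast hprod)]
  exact h1.trans (mul_le_mul h2 h3 (abs_nonneg _) (by positivity))

/-! ## The modified Bessel function -/

theorem integrableOn_besselK_integrand (ν : ℝ) {s : ℝ} (hs : 0 < s) :
    IntegrableOn (fun u => Real.exp (-s * Real.cosh u) * Real.cosh (ν * u)) (Set.Ioi 0) := by
  refine integrable_of_isBigO_exp_neg (b := 1) one_pos
    (Continuous.continuousOn (by fun_prop)) ?_
  -- The exponent is the maximum over `u` of `(|ν| + 1) u - s u² / 4`, with `cosh u ≥ u² / 4` and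
  -- one `u` kept for the decay `e^{-u}`.
  refine Asymptotics.IsBigO.of_bound (Real.exp ((|ν| + 1) ^ 2 / s)) ?_
  filter_upwards [eventually_ge_atTop 0] with u hu
  have h1 : Real.cosh (ν * u) ≤ Real.exp (|ν| * u) := by
    rw [← Real.cosh_abs, abs_mul, abs_of_nonneg hu]
    have h : 0 ≤ |ν| * u := by positivity
    rw [Real.cosh_eq]
    have := Real.exp_le_exp.2 (neg_le_self h)
    linarith
  have h2 : u ^ 2 / 4 ≤ Real.cosh u := by
    rw [Real.cosh_eq]
    have := Real.quadratic_le_exp_of_nonneg hu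
    have := Real.exp_pos (-u)
    linarith
  have h3 : -s * Real.cosh u + |ν| * u ≤ (|ν| + 1) ^ 2 / s + -1 * u := by
    have h4 : -s * Real.cosh u ≤ -s * (u ^ 2 / 4) := by
      rw [neg_mul, neg_mul]
      exact neg_le_neg (mul_le_mul_of_nonneg_left h2 hs.le)
    have h5 : (|ν| + 1) ^ 2 / s + -1 * u - (-s * (u ^ 2 / 4) + |ν| * u) =
        ((|ν| + 1) - s * u / 2) ^ 2 / s := by
      field_simp
      ring
    have h6 : 0 ≤ ((|ν| + 1) - s * u / 2) ^ 2 / s := by positivity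
    linarith
  rw [Real.norm_of_nonneg (mul_nonneg (Real.exp_pos _).le (Real.cosh_pos _).le),
    Real.norm_of_nonneg (Real.exp_pos _).le, ← Real.exp_add]
  calc Real.exp (-s * Real.cosh u) * Real.cosh (ν * u)
      ≤ Real.exp (-s * Real.cosh u) * Real.exp (|ν| * u) := by gcongr
    _ = Real.exp (-s * Real.cosh u + |ν| * u) := (Real.exp_add _ _).symm
    _ ≤ _ := Real.exp_le_exp.2 h3

theorem besselK_nonneg (ν s : ℝ) : 0 ≤ besselK ν s :=
  integral_nonneg fun _ => mul_nonneg (Real.exp_pos _).le (Real.cosh_pos _).le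

theorem besselK_add_le (ν : ℝ) {s h : ℝ} (hs : 0 < s) (hh : 0 ≤ h) :
    besselK ν (s + h) ≤ Real.exp (-h) * besselK ν s := by
  rw [besselK, besselK, ← integral_const_mul]
  refine setIntegral_mono (integrableOn_besselK_integrand ν (by positivity))
    ((integrableOn_besselK_integrand ν hs).const_mul _) fun u => ?_
  have h1 : h * 1 ≤ h * Real.cosh u := mul_le_mul_of_nonneg_left (Real.one_le_cosh u) hh
  rw [← mul_assoc, ← Real.exp_add]
  refine mul_le_mul_of_nonneg_right (Real.exp_le_exp.2 ?_) (Real.cosh_pos _).le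
  linarith

/-! ## Decay of the Fourier terms -/

theorem comp_eq_zero_of_mem_subCl {p : ℕ} {a : Cl ℂ n} (ha : a ∈ subCl ℂ ℂ n p)
    {A : Finset (Fin n)} {i : Fin n} (hi : i ∈ A) (hip : p ≤ i) : comp a A = 0 := by
  induction ha using Submodule.span_induction with
  | mem a ha =>
    obtain ⟨B, hB, rfl⟩ := ha
    rw [comp_blade, if_neg]
    rintro rfl
    exact absurd (hB i hi) (not_lt.2 hip)
  | zero => simp [comp]
  | add a b _ _ ha hb => rw [comp_add, ha, hb, add_zero]
  | smul c a _ ha => rw [comp_smul, ha, mul_zero]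

theorem blade_mul_gen_last (𝕜 : Type) [RCLike 𝕜] (A : Finset (Fin (n + 1)))
    (hA : ∀ i ∈ A, (i : ℕ) < n) :
    blade 𝕜 A * gen 𝕜 (Fin.last n) = blade 𝕜 (insert (Fin.last n) A) := by
  have h : (A.sort (· ≤ ·) ++ [Fin.last n]).Pairwise (· < ·) := by
    refine List.pairwise_append.2 ⟨(Finset.sortedLT_sort A).pairwise, by simp, ?_⟩
    intro i hi j hj
    rw [List.mem_singleton.1 hj]
    exact Fin.lt_def.2 (hA i ((Finset.mem_sort _).1 hi))
  have h2 : (A.sort (· ≤ ·) ++ [Fin.last n]).toFinset = insert (Fin.last n) A := by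
    ext i
    simp
  rw [← h2, ← listProd_sorted 𝕜 _ h]
  simp [blade, listProd]

/-- Together with `comp_eq_zero_of_mem_subCl`, this separates `α` from `β e_n`: they have no blade
in common. -/
theorem comp_mul_gen_last_eq_zero {a : Cl ℂ (n + 1)} (ha : a ∈ subCl ℂ ℂ (n + 1) n)
    {A : Finset (Fin (n + 1))} (hA : Fin.last n ∉ A) :
    comp (a * gen ℂ (Fin.last n)) A = 0 := by
  induction ha using Submodule.span_induction with
  | mem a ha =>
    obtain ⟨B, hB, rfl⟩ := ha
    rw [blade_mul_gen_last ℂ B hB, comp_blade, if_neg]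
    rintro rfl
    exact hA (Finset.mem_insert_self _ _)
  | zero => simp [comp]
  | add a b _ _ ha hb => rw [add_mul, comp_add, ha, hb, add_zero]
  | smul c a _ ha => rw [smul_mul_assoc, comp_smul, ha, mul_zero]

theorem norm_le_of_comp_le {𝕜 : Type} [RCLike 𝕜] {a b : Cl 𝕜 n} {c : ℝ} (hc : 0 ≤ c)
    (h : ∀ A, ‖comp a A‖ ≤ c * ‖comp b A‖) : ‖a‖ ≤ c * ‖b‖ := by
  rw [norm_eq_sqrt, norm_eq_sqrt, ← Real.sqrt_sq hc, ← Real.sqrt_mul (sq_nonneg c),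
    Finset.mul_sum]
  refine Real.sqrt_le_sqrt (Finset.sum_le_sum fun A _ => ?_)
  rw [← mul_pow]
  exact pow_le_pow_left₀ (norm_nonneg _) (h A) 2

theorem height_single_last (t : ℝ) :
    height (EuclideanSpace.single (Fin.last n) t : Para n) = t := by
  simp [height]

theorem fourierTerm_single_last (k : ℤ) (α β : Cl ℂ n) {ω : Para n} (hω : height ω = 0) (t : ℝ) :
    fourierTerm k α β ω (EuclideanSpace.single (Fin.last n) t) =
      ((t ^ (((k : ℝ) + 1) / 2) : ℝ) : ℂ) •
        (((besselK (((k : ℝ) + 1) / 2) (2 * Real.pi * ‖ω‖ * t) : ℝ) : ℂ) • α +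
          ((besselK (((k : ℝ) - 1) / 2) (2 * Real.pi * ‖ω‖ * t) : ℝ) : ℂ) •
            (β * unitVec ℂ (Fin.last n))) := by
  have h : inner ℝ ω (EuclideanSpace.single (Fin.last n) t) = 0 := by
    have : ω (Fin.last n) = 0 := hω
    rw [EuclideanSpace.inner_single_right, this, map_zero, mul_zero]
  rw [fourierTerm, height_single_last, h]
  simp

/-- The two Bessel functions decay differently, so cancellation between `α` and `β e_n` at `t = 1`
would spoil the comparison. There is none, since each component sees only one of the two summands.
-/
theorem norm_fourierTerm_le (hn : 1 ≤ n) (k : ℤ) {α β : Cl ℂ n} (hα : α ∈ subCl ℂ ℂ n (n - 1))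
    (hβ : β ∈ subCl ℂ ℂ n (n - 1)) {ω : Para n} (hω : height ω = 0) (hω0 : ω ≠ 0) {t : ℝ}
    (ht : 1 ≤ t) :
    ‖fourierTerm k α β ω (EuclideanSpace.single (Fin.last n) t)‖ ≤
      t ^ (((k : ℝ) + 1) / 2) * Real.exp (-(2 * Real.pi * ‖ω‖ * (t - 1))) *
        ‖fourierTerm k α β ω (EuclideanSpace.single (Fin.last n) 1)‖ := by
  obtain ⟨m, rfl⟩ : ∃ m, n = m + 1 := ⟨n - 1, by omega⟩
  have ht0 : 0 ≤ t := by linarith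
  have hK (ν : ℝ) : besselK ν (2 * Real.pi * ‖ω‖ * t) ≤
      Real.exp (-(2 * Real.pi * ‖ω‖ * (t - 1))) * besselK ν (2 * Real.pi * ‖ω‖ * 1) := by
    have h1 : 0 < ‖ω‖ := norm_pos_iff.2 hω0
    have h2 : 0 ≤ t - 1 := by linarith
    have h3 := besselK_add_le ν (s := 2 * Real.pi * ‖ω‖ * 1) (h := 2 * Real.pi * ‖ω‖ * (t - 1))
      (by positivity) (by positivity)
    rwa [← mul_add, add_sub_cancel] at h3
  rw [fourierTerm_single_last k α β hω, fourierTerm_single_last k α β hω]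
  refine norm_le_of_comp_le (by positivity) fun A => ?_
  simp only [comp_smul, comp_add, Real.one_rpow, Complex.ofReal_one, one_mul]
  have hcases (z : ℂ) (ν : ℝ) :
      ‖((t ^ (((k : ℝ) + 1) / 2) : ℝ) : ℂ) *
        (((besselK ν (2 * Real.pi * ‖ω‖ * t) : ℝ) : ℂ) * z)‖ ≤
      t ^ (((k : ℝ) + 1) / 2) * Real.exp (-(2 * Real.pi * ‖ω‖ * (t - 1))) *
        ‖((besselK ν (2 * Real.pi * ‖ω‖ * 1) : ℝ) : ℂ) * z‖ := by
    rw [norm_mul, norm_mul, norm_mul, Complex.norm_of_nonneg (by positivity),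
      Complex.norm_of_nonneg (besselK_nonneg _ _), Complex.norm_of_nonneg (besselK_nonneg _ _),
      mul_assoc (t ^ _), ← mul_assoc (Real.exp _)]
    gcongr
    exact hK ν
  by_cases hA : Fin.last m ∈ A
  · rw [comp_eq_zero_of_mem_subCl hα hA (by simp)]
    simpa only [mul_zero, zero_add] using hcases _ _
  · have : unitVec ℂ (Fin.last (m + 1)) = gen ℂ (Fin.last m) := rfl
    rw [this, comp_mul_gen_last_eq_zero hβ hA]
    simpa only [mul_zero, add_zero] using hcases _ _

/-! ### Decay of the whole expansion along the axis -/

theorem comp_complexify (a : Cl ℝ n) (A : Finset (Fin n)) :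
    comp (complexify a) A = ((comp a A : ℝ) : ℂ) := by
  simp only [complexify, comp_sum, comp_smul, comp_blade, mul_ite, mul_one, mul_zero,
    Finset.sum_ite_eq', Finset.mem_univ, if_true]

theorem norm_complexify (a : Cl ℝ n) : ‖complexify a‖ = ‖a‖ := by
  simp [norm_eq_sqrt, comp_complexify]

instance finiteDimensional_cl (𝕜 : Type) [RCLike 𝕜] : FiniteDimensional 𝕜 (Cl 𝕜 n) :=
  (bladeBasis 𝕜 n).finiteDimensional_of_finite

theorem HasFourierExpansion.exists_norm_le (hn : 1 ≤ n) {k : ℤ} {I : Subring (Cl ℝ n)} {N : ℕ}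
    {F : Para n → Cl ℝ n} {a₀ α₀ b₀ β₀ : Cl ℂ n} {α β : Para n → Cl ℂ n}
    (h : HasFourierExpansion k I N F a₀ α₀ b₀ β₀ α β)
    (h0 : ∀ t : ℝ, 0 < t → nullPart k a₀ α₀ b₀ β₀ t = 0)
    {δ : ℝ} (hδ : ∀ ω ∈ dualLattice I N, ω ≠ 0 → δ ≤ ‖ω‖) :
    ∃ S : ℝ, ∀ t : ℝ, 1 ≤ t → ‖F (EuclideanSpace.single (Fin.last n) t)‖ ≤
      t ^ (((k : ℝ) + 1) / 2) * Real.exp (-(2 * Real.pi * δ * (t - 1))) * S := by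
  have hmem (t : ℝ) (ht : 1 ≤ t) : EuclideanSpace.single (Fin.last n) t ∈ upperHalf n := by
    rw [mem_upperHalf, height_single_last]
    linarith
  -- In finite dimension unconditional convergence is absolute, so the single point `e_n` provides a
  -- majorant for all `t ≥ 1`.
  have hs := summable_norm_iff.2 (h.hasSum _ (hmem 1 le_rfl)).summable
  refine ⟨∑' ω : {ω : Para n // ω ∈ dualLattice I N ∧ ω ≠ 0},
    ‖fourierTerm k (α ω) (β ω) ω (EuclideanSpace.single (Fin.last n) 1)‖, fun t ht => ?_⟩
  have h1 := h.hasSum _ (hmem t ht)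
  rw [height_single_last, h0 t (by linarith), sub_zero] at h1
  rw [← norm_complexify, ← h1.tsum_eq]
  refine tsum_of_norm_bounded (hs.hasSum.mul_left _) fun ω => ?_
  refine (norm_fourierTerm_le hn k (h.αω_mem ω ω.2.1 ω.2.2) (h.βω_mem ω ω.2.1 ω.2.2) ω.2.1.1
    ω.2.2 ht).trans ?_
  have h2 : 0 ≤ t - 1 := by linarith
  have h3 := hδ ω ω.2.1 ω.2.2
  gcongr

theorem tendsto_smul_of_norm_le {F : ℝ → Cl ℝ n} {s b S : ℝ} (hb : 0 < b) (k : ℤ)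
    (h : ∀ t : ℝ, 1 ≤ t → ‖F t‖ ≤ t ^ s * Real.exp (-(b * (t - 1))) * S) :
    Tendsto (fun t => t ^ k • F t) atTop (𝓝 0) := by
  have h1 := (tendsto_rpow_mul_exp_neg_mul_atTop_nhds_zero (s + k) b hb).mul_const
    (Real.exp b * S)
  rw [zero_mul] at h1
  refine squeeze_zero_norm' ?_ h1
  filter_upwards [eventually_ge_atTop 1] with t ht
  have ht0 : 0 < t := by linarith
  rw [norm_smul, Real.norm_of_nonneg (by positivity), Real.rpow_add ht0, Real.rpow_intCast]
  refine (mul_le_mul_of_nonneg_left (h t ht) (by positivity)).trans_eq ?_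
  rw [show -(b * (t - 1)) = -b * t + b by ring, Real.exp_add]
  ring

end CliffordForms

open CliffordForms

theorem theorem8 (n : ℕ) (hn : 1 ≤ n) (k : ℤ) (hk : Even k)
    (p : ℕ) (hp : p = n ∨ p + 1 = n)
    (I : Subring (Cl ℝ n)) (hI : IsZOrder p I)
    (hrev : ∀ a ∈ I, CliffordAlgebra.reverse a ∈ I)
    (hinv : ∀ a ∈ I, CliffordAlgebra.involute a ∈ I)
    (N : ℕ) (hN : 1 ≤ N)
    (f : Para n → Cl ℝ n) (hf : IsAutomorphicForm k I N f)
    (𝓡 : Set (Mat n)) (h𝓡 : IsCosetSystem I N 𝓡)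
    (hF : ∀ R ∈ 𝓡, ∃ (a₀ α₀ b₀ β₀ : Cl ℂ n) (α β : Para n → Cl ℂ n),
      HasFourierExpansion k I N (fun x => slash k f R x) a₀ α₀ b₀ β₀ α β ∧
      ∀ t : ℝ, 0 < t → nullPart k a₀ α₀ b₀ β₀ t = 0) :
    IsCuspForm k I N f := by
  refine ⟨hf, fun M hM => ?_⟩
  obtain ⟨R, ⟨hR, G, hG, rfl⟩, -⟩ := h𝓡.2 M hM
  have hRS : IsSAV R := (h𝓡.1 hR).1.toIsSAV
  obtain ⟨a₀, α₀, b₀, β₀, α, β, hexp, h0⟩ := hF R hR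
  obtain ⟨δ, hδ, hδ'⟩ := exists_le_norm_of_mem_dualLattice (by omega) hI hN
  obtain ⟨S, hS⟩ := hexp.exists_norm_le hn h0 hδ'
  -- The exponent `0` stands for the absent factor when `k > 0`.
  have hlim := tendsto_smul_of_norm_le (by positivity : 0 < 2 * Real.pi * δ)
    (if 0 < k then 0 else -k) hS
  refine hlim.congr' ?_
  filter_upwards [eventually_gt_atTop 0] with t ht
  have hx : EuclideanSpace.single (Fin.last n) t ∈ upperHalf n := by
    rwa [mem_upperHalf, height_single_last]
  -- `f|G = f` is known on the half-space only, which suffices because `R` maps the half-space into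
  -- itself.
  rw [slash_mul hn k f hG.1.1.toIsSAV hRS hx, ← slash_congr hn k (hf.inv G hG) hRS hx]
  split_ifs <;> simp
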